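/- Let $A$ be an Artin algebra, i.e. an algebra over a commutative artinian ring $R$ which is finitely generated as an $R$-module, and let $\operatorname{mod}A$ be the category of finitely generated right $A$-modules. Let $K_0(A)$ be the abelian group generated by the symbols $[M]$, $M\in\operatorname{mod}A$, modulo the relations $[M]=[M']+[M'']$ whenever $M\cong M'\oplus M''$, and $[P]=0$ for $P$ projective. Let $\bar\Omega:K_0(A)\to K_0(A)$ be the endomorphism with $\bar\Omega[M]=[\Omega M]$, where $\Omega M$ is the kernel of the projective cover $P(M)\to M$. For $M\in\operatorname{mod}A$ let $\langle\operatorname{add}M\rangle\subseteq K_0(A)$ be the (finitely generated) subgroup generated by the classes of the indecomposable direct summands of $M$. For an endomorphism $f$ of an abelian group and a finitely generated subgroup $X$, put $$\eta_f(X)=\min\{k\in\mathbb N : f|_{f^m(X)}:f^m(X)\to f^{m+1}(X)\text{ is an isomorphism for all }m\ge k\}.$$ The Igusa--Todorov function is $\phi(M)=\eta_{\bar\Omega}(\langle\operatorname{add}M\rangle)$. A module $G\in\operatorname{mod}A$ is Gorenstein projective if it is isomorphic to the kernel of a differential in an exact complex $P^\bullet$, indexed by $\mathbb Z$, of finitely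 generated projective $A$-modules such that $\operatorname{Hom}_A(P^\bullet,Q)$ is exact for every finitely generated projective $A$-module $Q$. Let $\mathcal{GP}_A\subseteq\operatorname{mod}A$ be the class of these modules, and $\langle\mathcal{GP}_A\rangle\subseteq K_0(A)$ the subgroup generated by their classes; it satisfies $\bar\Omega\langle\mathcal{GP}_A\rangle\subseteq\langle\mathcal{GP}_A\rangle$, so $\bar\Omega$ induces an endomorphism $\bar\Omega_{\mathcal{GP}_A}$ of $K_0(A)/\langle\mathcal{GP}_A\rangle$. Put $$\Phi_{[\mathcal{GP}_A]}(M)=\eta_{\bar\Omega_{\mathcal{GP}_A}}\bigl((\langle\operatorname{add}M\rangle+\langle\mathcal{GP}_A\rangle)/\langle\mathcal{GP}_A\rangle\bigr).$$ Then for every $M\in\operatorname{mod}A$ there is a Gorenstein projective module $G\in\operatorname{mod}A$ such that $$\Phi_{[\mathcal{GP}_A]}(M)=\phi(M\oplus G).$$ -/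

import Mathlib

namespace IgusaTodorov

universe u

/-! ## The number attached to an endomorphism and a finitely generated subgroup -/

/-- `η_f(X)`: the least `k` such that, for all `m ≥ k`, the map `f : f^m(X) → f^(m+1)(X)`
(which is always surjective) is an isomorphism.  Such a `k` exists when `X` is finitely generated,
see `eta_set_nonempty`. -/
noncomputable def eta {G : Type*} [AddCommGroup G] (f : G →+ G) (X : AddSubgroup G) : ℕ :=
  sInf {k : ℕ | ∀ m ≥ k, Set.InjOn f (f^[m] '' (X : Set G))}

theorem eta_set_nonempty {G : Type*} [AddCommGroup G] (f : G →+ G) (X : AddSubgroup G)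
    (hX : X.FG) : {k : ℕ | ∀ m ≥ k, Set.InjOn f (f^[m] '' (X : Set G))}.Nonempty := by
  let Y : Submodule ℤ G := AddSubgroup.toIntSubmodule X
  have hY : Y.FG := (Submodule.fg_iff_addSubgroup_fg Y).2 (by simpa [Y] using hX)
  have : IsNoetherian ℤ Y := isNoetherian_of_fg_of_noetherian Y hY
  let F : Module.End ℤ G := f.toIntLinearMap
  have hF : ∀ m x, (F ^ m) x = f^[m] x := fun m x => by
    rw [Module.End.pow_apply]; rfl
  let K : ℕ →o Submodule ℤ Y :=
    ⟨fun m => LinearMap.ker ((F ^ m).domRestrict Y), by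
      intro a b hab x hx
      obtain ⟨c, rfl⟩ := Nat.exists_eq_add_of_le' hab
      simp only [LinearMap.mem_ker, LinearMap.domRestrict_apply] at hx ⊢
      rw [pow_add, Module.End.mul_apply, hx, map_zero]⟩
  obtain ⟨n, hn⟩ := monotone_stabilizes_iff_noetherian.2 (inferInstance : IsNoetherian ℤ Y) K
  refine ⟨n, fun m hm => ?_⟩
  rintro _ ⟨x, hx, rfl⟩ _ ⟨y, hy, rfl⟩ h
  let z : Y := ⟨x - y, X.sub_mem hx hy⟩
  have h1 : z ∈ K (m + 1) := by
    change (F ^ (m + 1)) (x - y) = 0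
    rw [map_sub, hF, hF, Function.iterate_succ_apply', Function.iterate_succ_apply', h, sub_self]
  have h2 : z ∈ K m := by rwa [← hn m hm, hn (m + 1) (by omega)]
  have h3 : (F ^ m) (x - y) = 0 := h2
  rw [map_sub, hF, hF] at h3
  exact sub_eq_zero.1 h3

/-! ## Finitely generated modules and their classes -/

section

variable (Λ : Type u) [Ring Λ]

/-- The relations of `K₀`: `[M] - [M'] - [M'']` if `M ≅ M' ⊕ M''`, and `[P]` for `P` projective. -/
inductive Relator : FreeAbelianGroup (FGModuleCat.{u} Λ) → Prop
  | sum (M M' M'' : FGModuleCat.{u} Λ) (e : M ≃ₗ[Λ] (M' × M'')) :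
      Relator (FreeAbelianGroup.of M - FreeAbelianGroup.of M' - FreeAbelianGroup.of M'')
  | proj (P : FGModuleCat.{u} Λ) (h : Module.Projective Λ P) : Relator (FreeAbelianGroup.of P)

/-- The group `K₀`: all symbols `[M]` with `M` a finitely generated module, modulo the relations
above. -/
abbrev K0 : Type (u + 1) :=
  FreeAbelianGroup (FGModuleCat.{u} Λ) ⧸ AddSubgroup.closure {x | Relator Λ x}

end

section

variable {Λ : Type u} [Ring Λ]

/-- The class `[M]` in `K₀`. -/
def cls (M : FGModuleCat.{u} Λ) : K0 Λ :=
  QuotientAddGroup.mk (FreeAbelianGroup.of M)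

theorem cls_sum {M M' M'' : FGModuleCat.{u} Λ} (e : M ≃ₗ[Λ] (M' × M'')) :
    cls M = cls M' + cls M'' := by
  have h : (QuotientAddGroup.mk (FreeAbelianGroup.of M - FreeAbelianGroup.of M' -
      FreeAbelianGroup.of M'') : K0 Λ) = 0 :=
    (QuotientAddGroup.eq_zero_iff _).2 (AddSubgroup.subset_closure (Relator.sum M M' M'' e))
  have h' : cls M - cls M' - cls M'' = 0 := h
  rw [sub_sub, sub_eq_zero] at h'
  exact h'

theorem cls_proj (P : FGModuleCat.{u} Λ) (h : Module.Projective Λ P) : cls P = 0 :=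
  (QuotientAddGroup.eq_zero_iff _).2 (AddSubgroup.subset_closure (Relator.proj P h))

theorem cls_congr {M N : FGModuleCat.{u} Λ} (e : M ≃ₗ[Λ] N) : cls M = cls N := by
  have h := cls_sum (M := M) (M' := N) (M'' := FGModuleCat.of Λ PUnit.{u + 1})
    (e.trans (LinearEquiv.prodUnique (R := Λ) (M := N) (M₂ := PUnit.{u + 1})).symm)
  rwa [cls_proj (FGModuleCat.of Λ PUnit.{u + 1})
    (inferInstanceAs (Module.Projective Λ PUnit.{u + 1})), add_zero] at h

/-- `N` is (isomorphic to) a direct summand of `M`. -/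
def IsSummand (N M : FGModuleCat.{u} Λ) : Prop :=
  ∃ N' : FGModuleCat.{u} Λ, Nonempty (M ≃ₗ[Λ] (N × N'))

/-- `⟨add M⟩`: the subgroup of `K₀` generated by the classes of the indecomposable direct summands
of `M`. -/
def addSpan (M : FGModuleCat.{u} Λ) : AddSubgroup (K0 Λ) :=
  AddSubgroup.closure
    {x | ∃ N : FGModuleCat.{u} Λ, CategoryTheory.Indecomposable N.obj ∧ IsSummand N M ∧ x = cls N}

/-- `⟨𝒟⟩`: the subgroup of `K₀` generated by the classes of the modules in `𝒟`. -/
def classSpan (D : Set (FGModuleCat.{u} Λ)) : AddSubgroup (K0 Λ) :=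
  AddSubgroup.closure (cls '' D)

/-! ## Finitely many indecomposable summands

For a finitely generated module `M` over an artinian ring, `⟨add M⟩` is finitely generated. -/

theorem isSummand_of_retract {N Y : FGModuleCat.{u} Λ} [IsArtinianRing Λ] (s : N →ₗ[Λ] Y)
    (p : Y →ₗ[Λ] N) (h : ∀ x, p (s x) = x) : IsSummand N Y := by
  refine ⟨FGModuleCat.of Λ (LinearMap.ker p), ⟨?_⟩⟩
  exact
    { toFun := fun y => (p y, ⟨y - s (p y), by simp [h]⟩)
      invFun := fun x => s x.1 + x.2.1
      map_add' := by
        intro a b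
        ext
        · simp
        · simp
          abel
      map_smul' := by
        intro c a
        ext <;> simp [smul_sub]
      left_inv := by
        intro y
        simp
      right_inv := by
        rintro ⟨n, k, hk⟩
        have hk' : p k = 0 := hk
        ext <;> simp [h, hk'] }

theorem isZero_iff_subsingleton (X : ModuleCat.{u} Λ) :
    CategoryTheory.Limits.IsZero X ↔ Subsingleton X :=
  ModuleCat.isZero_iff_subsingleton

theorem indecomposable_cases {N : FGModuleCat.{u} Λ} (hN : CategoryTheory.Indecomposable N.obj)
    {Y Z : Type u} [AddCommGroup Y] [Module Λ Y] [AddCommGroup Z] [Module Λ Z]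
    (e : N ≃ₗ[Λ] (Y × Z)) : Subsingleton Y ∨ Subsingleton Z := by
  have := hN.2 (ModuleCat.of Λ Y) (ModuleCat.of Λ Z)
    ((LinearEquiv.toModuleIso e : N.obj ≅ ModuleCat.of Λ (Y × Z)) ≪≫
      (ModuleCat.biprodIsoProd (ModuleCat.of Λ Y) (ModuleCat.of Λ Z)).symm)
  simpa only [isZero_iff_subsingleton] using this

theorem bijective_or_of_indecomposable [IsArtinianRing Λ] {N : FGModuleCat.{u} Λ}
    (hN : CategoryTheory.Indecomposable N.obj) (f g : N →ₗ[Λ] N) (hfg : ∀ x, f x + g x = x) :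
    Function.Bijective f ∨ Function.Bijective g := by
  let F : Module.End Λ N := f
  obtain ⟨k, hk, hk1⟩ := (F.eventually_isCompl_ker_pow_range_pow.and
    (Filter.eventually_ge_atTop 1)).exists
  rcases indecomposable_cases hN (Submodule.prodEquivOfIsCompl _ _ hk).symm with h | h
  · left
    have h1 : LinearMap.ker (F ^ k) = ⊥ := (Submodule.subsingleton_iff_eq_bot).1 h
    refine IsArtinian.bijective_of_injective_endomorphism f (LinearMap.ker_eq_bot.1 ?_)
    rw [eq_bot_iff, ← h1]
    intro x hx
    obtain ⟨j, rfl⟩ := Nat.exists_eq_add_of_le' hk1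
    have hx' : F x = 0 := hx
    rw [LinearMap.mem_ker, pow_succ, Module.End.mul_apply, hx', map_zero]
  · right
    have h1 : LinearMap.range (F ^ k) = ⊥ := (Submodule.subsingleton_iff_eq_bot).1 h
    have h2 : IsNilpotent F := ⟨k, LinearMap.range_eq_bot.1 h1⟩
    have h3 : g = (1 - F : Module.End Λ N) := by
      ext1 x
      exact eq_sub_of_add_eq' (hfg x)
    rw [h3]
    exact (Module.End.isUnit_iff _).1 h2.isUnit_one_sub

theorem isSummand_cases [IsArtinianRing Λ] {N M Y Z : FGModuleCat.{u} Λ}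
    (hN : CategoryTheory.Indecomposable N.obj) (h : IsSummand N M) (e : M ≃ₗ[Λ] (Y × Z)) :
    IsSummand N Y ∨ IsSummand N Z := by
  obtain ⟨N', ⟨φ⟩⟩ := h
  let i : N →ₗ[Λ] M := φ.symm.toLinearMap ∘ₗ LinearMap.inl Λ N N'
  let p : M →ₗ[Λ] N := LinearMap.fst Λ N N' ∘ₗ φ.toLinearMap
  have key : ∀ {X : FGModuleCat.{u} Λ} (a : N →ₗ[Λ] X) (b : X →ₗ[Λ] N),
      Function.Bijective (b ∘ₗ a) → IsSummand N X := fun {X} a b hb =>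
    isSummand_of_retract (a ∘ₗ (LinearEquiv.ofBijective (b ∘ₗ a) hb).symm.toLinearMap) b
      fun x => (LinearEquiv.ofBijective (b ∘ₗ a) hb).apply_symm_apply x
  let iY := LinearMap.fst Λ Y Z ∘ₗ e.toLinearMap ∘ₗ i
  let iZ := LinearMap.snd Λ Y Z ∘ₗ e.toLinearMap ∘ₗ i
  let pY := p ∘ₗ e.symm.toLinearMap ∘ₗ LinearMap.inl Λ Y Z
  let pZ := p ∘ₗ e.symm.toLinearMap ∘ₗ LinearMap.inr Λ Y Z
  refine (bijective_or_of_indecomposable hN (pY ∘ₗ iY) (pZ ∘ₗ iZ) fun x => ?_).imp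
    (key iY pY) (key iZ pZ)
  have h1 : p (i x) = x := by simp [i, p]
  have h2 : p (e.symm ((e (i x)).1, 0)) + p (e.symm (0, (e (i x)).2)) = p (i x) := by
    rw [← map_add, ← map_add]
    simp
  exact h2.trans h1

theorem finite_summandClasses [IsArtinianRing Λ] (n : ℕ∞) :
    ∀ M : FGModuleCat.{u} Λ, Module.length Λ M = n →
      {x | ∃ N : FGModuleCat.{u} Λ, CategoryTheory.Indecomposable N.obj ∧ IsSummand N M ∧
        x = cls N}.Finite := by
  induction n using WellFoundedLT.induction with
  | _ n ih =>
  intro M hM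
  by_cases hI : CategoryTheory.Indecomposable M.obj
  · refine (Set.finite_singleton (cls M)).subset ?_
    rintro _ ⟨N, hN, ⟨N', ⟨φ⟩⟩, rfl⟩
    rcases indecomposable_cases hI φ with h | h
    · exact absurd ((isZero_iff_subsingleton _).2 h) hN.1
    · have : Unique N' := ⟨⟨0⟩, fun _ => Subsingleton.elim _ _⟩
      exact (cls_congr (φ.trans LinearEquiv.prodUnique)).symm
  by_cases h0 : Subsingleton M
  · convert Set.finite_empty
    rw [Set.eq_empty_iff_forall_notMem]
    rintro _ ⟨N, hN, ⟨N', ⟨φ⟩⟩, rfl⟩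
    refine hN.1 ((isZero_iff_subsingleton _).2 ?_)
    exact (φ.symm.injective.comp (LinearMap.inl_injective (R := Λ) (M₂ := N'))).subsingleton
  have hI' : ∃ Y Z : ModuleCat.{u} Λ, ∃ _ : M.obj ≅ CategoryTheory.Limits.biprod Y Z,
      ¬ Subsingleton Y ∧ ¬ Subsingleton Z := by
    by_contra! hc
    refine hI ⟨fun h => h0 ((isZero_iff_subsingleton _).1 h), fun Y Z e => ?_⟩
    rw [isZero_iff_subsingleton, isZero_iff_subsingleton]
    by_contra! hc'
    exact absurd (hc Y Z e hc'.1) (not_subsingleton_iff_nontrivial.2 hc'.2)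
  obtain ⟨Y, Z, e, hY, hZ⟩ := hI'
  let e' : M ≃ₗ[Λ] (Y × Z) := (e ≪≫ ModuleCat.biprodIsoProd Y Z).toLinearEquiv
  have fY : Module.Finite Λ Y := Module.Finite.of_surjective
    (LinearMap.fst Λ Y Z ∘ₗ e'.toLinearMap) (Prod.fst_surjective.comp e'.surjective)
  have fZ : Module.Finite Λ Z := Module.Finite.of_surjective
    (LinearMap.snd Λ Y Z ∘ₗ e'.toLinearMap) (Prod.snd_surjective.comp e'.surjective)
  have hl : n = Module.length Λ Y + Module.length Λ Z := by
    rw [← hM, e'.length_eq, Module.length_prod]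
  have tY : Module.length Λ Y ≠ ⊤ := Module.length_ne_top
  have tZ : Module.length Λ Z ≠ ⊤ := Module.length_ne_top
  have pY : Module.length Λ Y ≠ 0 := fun h => hY ((Module.length_eq_zero_iff (R := Λ)).1 h)
  have pZ : Module.length Λ Z ≠ 0 := fun h => hZ ((Module.length_eq_zero_iff (R := Λ)).1 h)
  have lt : ∀ {a b : ℕ∞}, a ≠ ⊤ → b ≠ 0 → a < a + b := fun {a b} ha hb => by
    simpa using (ENat.add_lt_add_iff_left ha).2 (pos_iff_ne_zero.2 hb)
  have sY := ih (Module.length Λ Y) (by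
    rw [hl]; exact lt tY pZ) (FGModuleCat.of Λ Y) rfl
  have sZ := ih (Module.length Λ Z) (by
    rw [hl, add_comm]; exact lt tZ pY) (FGModuleCat.of Λ Z) rfl
  refine (sY.union sZ).subset ?_
  rintro _ ⟨N, hN, hs, rfl⟩
  exact (isSummand_cases (Y := FGModuleCat.of Λ Y) (Z := FGModuleCat.of Λ Z) hN hs e').imp
    (fun h => ⟨N, hN, h, rfl⟩) (fun h => ⟨N, hN, h, rfl⟩)

theorem addSpan_fg [IsArtinianRing Λ] (M : FGModuleCat.{u} Λ) : (addSpan M).FG :=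
  (AddSubgroup.fg_iff _).2 ⟨_, rfl, finite_summandClasses _ M rfl⟩

/-- Schanuel's lemma. -/
theorem schanuel {P Q M N : Type*} [AddCommGroup P] [Module Λ P] [AddCommGroup Q] [Module Λ Q]
    [AddCommGroup M] [Module Λ M] [AddCommGroup N] [Module Λ N]
    [Module.Projective Λ P] [Module.Projective Λ Q] (f : P →ₗ[Λ] M) (g : Q →ₗ[Λ] N)
    (hf : Function.Surjective f) (hg : Function.Surjective g) (e : M ≃ₗ[Λ] N) :
    Nonempty ((P × LinearMap.ker g) ≃ₗ[Λ] (Q × LinearMap.ker f)) := by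
  obtain ⟨s, hs⟩ := Module.projective_lifting_property g (e.toLinearMap ∘ₗ f) hg
  obtain ⟨t, ht⟩ := Module.projective_lifting_property f (e.symm.toLinearMap ∘ₗ g) hf
  have hs' : ∀ p, g (s p) = e (f p) := fun p => LinearMap.congr_fun hs p
  have ht' : ∀ q, f (t q) = e.symm (g q) := fun q => LinearMap.congr_fun ht q
  have h1 : ∀ x : P × LinearMap.ker g, x.1 - t (s x.1 + x.2) ∈ LinearMap.ker f := by
    rintro ⟨p, l, hl⟩
    have hl' : g l = 0 := hl
    simp [ht', hs', hl']
  have h2 : ∀ y : Q × LinearMap.ker f, y.1 - s (t y.1 + y.2) ∈ LinearMap.ker g := by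
    rintro ⟨q, k, hk⟩
    have hk' : f k = 0 := hk
    simp [ht', hs', hk']
  refine ⟨
    { toFun := fun x => (s x.1 + x.2, ⟨x.1 - t (s x.1 + x.2), h1 x⟩)
      invFun := fun y => (t y.1 + y.2, ⟨y.1 - s (t y.1 + y.2), h2 y⟩)
      map_add' := ?_
      map_smul' := ?_
      left_inv := ?_
      right_inv := ?_ }⟩
  · rintro ⟨p, l⟩ ⟨p', l'⟩
    ext <;> simp <;> abel
  · rintro c ⟨p, l⟩
    ext <;> simp [smul_sub, smul_add]
  · rintro ⟨p, l⟩
    ext <;> simp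
  · rintro ⟨q, k⟩
    ext <;> simp

/-! ## Projective covers and syzygies -/

/-- `f : P → M` is a projective cover: `P` is projective, and `f` is surjective with superfluous
kernel. -/
structure IsProjectiveCover {P M : Type*} [AddCommGroup P] [Module Λ P] [AddCommGroup M]
    [Module Λ M] (f : P →ₗ[Λ] M) : Prop where
  projective : Module.Projective Λ P
  surjective : Function.Surjective f
  superfluous : ∀ L : Submodule Λ P, L ⊔ LinearMap.ker f = ⊤ → L = ⊤

variable [IsArtinianRing Λ]

theorem exists_projectiveCover (M : FGModuleCat.{u} Λ) :
    ∃ (P : FGModuleCat.{u} Λ) (f : P →ₗ[Λ] M), IsProjectiveCover f := by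
  obtain ⟨n, f, hf⟩ := Module.Finite.exists_fin' Λ M
  have hwf : WellFounded ((· < ·) : Submodule Λ (Fin n → Λ) → _ → Prop) := wellFounded_lt
  obtain ⟨N, hN, hmin⟩ := hwf.has_min {N : Submodule Λ (Fin n → Λ) | N.map f = ⊤}
    ⟨⊤, by simpa [LinearMap.range_eq_top] using hf⟩
  have hN' : N.map f = ⊤ := hN
  have hmin' : ∀ L ≤ N, L.map f = ⊤ → L = N := fun L hL hLf =>
    by_contra fun hne => hmin L hLf (lt_of_le_of_ne hL hne)
  have hs : Function.Surjective (f.domRestrict N) := by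
    rw [← LinearMap.range_eq_top, LinearMap.range_domRestrict, hN']
  obtain ⟨g, hg⟩ := Module.projective_lifting_property (f.domRestrict N) f hs
  have hg' : ∀ x, f (g x) = f x := fun x => LinearMap.congr_fun hg x
  have hsurj : Function.Surjective (g ∘ₗ N.subtype) := by
    have h1 : ((LinearMap.range (g ∘ₗ N.subtype)).map N.subtype) = N := by
      refine hmin' _ (Submodule.map_subtype_le _ _) ?_
      rw [eq_top_iff, ← hN']
      rintro _ ⟨x, hx, rfl⟩
      exact ⟨_, ⟨_, ⟨⟨x, hx⟩, rfl⟩, rfl⟩, hg' x⟩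
    rw [← LinearMap.range_eq_top]
    apply Submodule.map_injective_of_injective N.injective_subtype
    rw [h1, Submodule.map_top, Submodule.range_subtype]
  have hbij : Function.Bijective (g ∘ₗ N.subtype) :=
    ⟨IsNoetherian.injective_of_surjective_endomorphism _ hsurj, hsurj⟩
  let e : N ≃ₗ[Λ] N := LinearEquiv.ofBijective _ hbij
  have hproj : Module.Projective Λ N := by
    refine Module.Projective.of_split N.subtype (e.symm.toLinearMap ∘ₗ g) ?_
    ext1 x
    exact e.symm_apply_apply x
  refine ⟨FGModuleCat.of Λ N, f.domRestrict N, hproj, hs, fun L hL => ?_⟩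
  have h2 : L.map N.subtype = N := by
    refine hmin' _ (Submodule.map_subtype_le _ _) ?_
    have h3 : (L ⊔ LinearMap.ker (f.domRestrict N)).map (f.domRestrict N) = ⊤ := by
      rw [hL, Submodule.map_top, LinearMap.range_eq_top]; exact hs
    rw [Submodule.map_sup, LinearMap.le_ker_iff_map.1 le_rfl, sup_bot_eq] at h3
    rw [← Submodule.map_comp]
    exact h3
  apply Submodule.map_injective_of_injective N.injective_subtype
  rw [h2, Submodule.map_top, Submodule.range_subtype]

/-- The projective cover `P(M)`. -/
noncomputable def projCover (M : FGModuleCat.{u} Λ) : FGModuleCat.{u} Λ :=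
  (exists_projectiveCover M).choose

/-- The map `P(M) → M`. -/
noncomputable def projCoverMap (M : FGModuleCat.{u} Λ) : projCover M →ₗ[Λ] M :=
  (exists_projectiveCover M).choose_spec.choose

theorem projCoverMap_spec (M : FGModuleCat.{u} Λ) : IsProjectiveCover (projCoverMap M) :=
  (exists_projectiveCover M).choose_spec.choose_spec

/-- The kernel of a map of finitely generated modules, as a finitely generated module. -/
noncomputable abbrev kerMod {P M : FGModuleCat.{u} Λ} (f : P →ₗ[Λ] M) : FGModuleCat.{u} Λ :=
  FGModuleCat.of Λ (LinearMap.ker f)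

/-- The syzygy `Ω(M)`: the kernel of the projective cover `P(M) → M`. -/
noncomputable def syzygy (M : FGModuleCat.{u} Λ) : FGModuleCat.{u} Λ :=
  kerMod (projCoverMap M)


theorem cls_ker_eq {P Q M N : FGModuleCat.{u} Λ} (hP : Module.Projective Λ P)
    (hQ : Module.Projective Λ Q) (f : P →ₗ[Λ] M) (g : Q →ₗ[Λ] N)
    (hf : Function.Surjective f) (hg : Function.Surjective g) (e : M ≃ₗ[Λ] N) :
    cls (kerMod f) = cls (kerMod g) := by
  obtain ⟨φ⟩ := schanuel f g hf hg e
  have h1 : cls (FGModuleCat.of Λ (P × LinearMap.ker g)) = cls P + cls (kerMod g) :=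
    cls_sum (M := FGModuleCat.of Λ (P × LinearMap.ker g)) (LinearEquiv.refl Λ _)
  have h2 : cls (FGModuleCat.of Λ (P × LinearMap.ker g)) = cls Q + cls (kerMod f) :=
    cls_sum (M := FGModuleCat.of Λ (P × LinearMap.ker g)) φ
  rw [cls_proj P hP, zero_add] at h1
  rw [cls_proj Q hQ, zero_add] at h2
  rw [← h1, ← h2]

/-- In `K₀`, the class of a syzygy may be computed with any projective presentation. -/
theorem cls_syzygy_eq {Q M N : FGModuleCat.{u} Λ} (hQ : Module.Projective Λ Q) (g : Q →ₗ[Λ] N)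
    (hg : Function.Surjective g) (e : M ≃ₗ[Λ] N) : cls (syzygy M) = cls (kerMod g) :=
  cls_ker_eq (projCoverMap_spec M).projective hQ _ g (projCoverMap_spec M).surjective hg e

theorem cls_syzygy_sum {M M' M'' : FGModuleCat.{u} Λ} (e : M ≃ₗ[Λ] (M' × M'')) :
    cls (syzygy M) = cls (syzygy M') + cls (syzygy M'') := by
  have h' := projCoverMap_spec M'
  have h'' := projCoverMap_spec M''
  have := h'.projective
  have := h''.projective
  let g := (projCoverMap M').prodMap (projCoverMap M'')
  have hg : Function.Surjective g := Function.Surjective.prodMap h'.surjective h''.surjective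
  rw [cls_syzygy_eq (Q := FGModuleCat.of Λ (projCover M' × projCover M''))
    (N := FGModuleCat.of Λ (M' × M''))
    (inferInstanceAs (Module.Projective Λ (projCover M' × projCover M''))) g hg e]
  refine cls_sum (M := FGModuleCat.of Λ (LinearMap.ker g)) (M' := syzygy M') (M'' := syzygy M'') ?_
  exact
    { toFun := fun x => (⟨x.1.1, congrArg Prod.fst x.2⟩, ⟨x.1.2, congrArg Prod.snd x.2⟩)
      invFun := fun y => ⟨(y.1.1, y.2.1), Prod.ext y.1.2 y.2.2⟩
      map_add' := fun _ _ => rfl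
      map_smul' := fun _ _ => rfl
      left_inv := fun _ => rfl
      right_inv := fun _ => rfl }

theorem cls_syzygy_proj (P : FGModuleCat.{u} Λ) (hP : Module.Projective Λ P) :
    cls (syzygy P) = 0 := by
  rw [cls_syzygy_eq hP (LinearMap.id : P →ₗ[Λ] P) Function.surjective_id (LinearEquiv.refl Λ P)]
  refine cls_proj _ ?_
  have : Subsingleton (LinearMap.ker (LinearMap.id : P →ₗ[Λ] P)) := by
    rw [LinearMap.ker_id]; infer_instance
  exact inferInstanceAs (Module.Projective Λ (LinearMap.ker (LinearMap.id : P →ₗ[Λ] P)))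

/-- The endomorphism `Ω̄` of `K₀` with `Ω̄ [M] = [Ω M]`. -/
noncomputable def omegaBar : K0 Λ →+ K0 Λ :=
  QuotientAddGroup.lift _ (FreeAbelianGroup.lift fun M => cls (syzygy M)) (by
    rw [AddSubgroup.closure_le]
    rintro _ (⟨M, M', M'', e⟩ | ⟨P, hP⟩)
    · simp [cls_syzygy_sum e]
    · simp [cls_syzygy_proj P hP])

theorem omegaBar_cls (M : FGModuleCat.{u} Λ) : omegaBar (cls M) = cls (syzygy M) :=
  FreeAbelianGroup.lift_apply_of _ _

/-! ## The Igusa-Todorov function and its relative version -/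

/-- The Igusa-Todorov function `φ`. -/
noncomputable def phi (M : FGModuleCat.{u} Λ) : ℕ :=
  eta omegaBar (addSpan M)

/-- The minimum defining `φ(M)` is attained. -/
theorem phi_isLeast (M : FGModuleCat.{u} Λ) :
    IsLeast {k : ℕ | ∀ m ≥ k, Set.InjOn omegaBar (omegaBar^[m] '' (addSpan M : Set (K0 Λ)))}
      (phi M) :=
  ⟨Nat.sInf_mem (eta_set_nonempty _ _ (addSpan_fg M)), fun _ hk => Nat.sInf_le hk⟩

/-- The endomorphism of `K₀ / ⟨𝒟⟩` induced by `Ω̄`, where `Ω̄ ⟨𝒟⟩ ⊆ ⟨𝒟⟩`. -/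
noncomputable def omegaBarRel (D : Set (FGModuleCat.{u} Λ))
    (hD : classSpan D ≤ (classSpan D).comap omegaBar) :
    (K0 Λ ⧸ classSpan D) →+ (K0 Λ ⧸ classSpan D) :=
  QuotientAddGroup.map (classSpan D) (classSpan D) omegaBar hD

/-- The relative Igusa-Todorov function `Φ_[𝒟]`: the number `η` of the endomorphism of
`K₀ / ⟨𝒟⟩` induced by `Ω̄` and the image of `⟨add M⟩` in `K₀ / ⟨𝒟⟩`. -/
noncomputable def phiRel (D : Set (FGModuleCat.{u} Λ))
    (hD : classSpan D ≤ (classSpan D).comap omegaBar) (M : FGModuleCat.{u} Λ) : ℕ :=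
  eta (omegaBarRel D hD) ((addSpan M).map (QuotientAddGroup.mk' (classSpan D)))

/-- The minimum defining `Φ_[𝒟](M)` is attained. -/
theorem phiRel_isLeast (D : Set (FGModuleCat.{u} Λ))
    (hD : classSpan D ≤ (classSpan D).comap omegaBar) (M : FGModuleCat.{u} Λ) :
    IsLeast {k : ℕ | ∀ m ≥ k, Set.InjOn (omegaBarRel D hD) ((omegaBarRel D hD)^[m] ''
      ((addSpan M).map (QuotientAddGroup.mk' (classSpan D)) : Set (K0 Λ ⧸ classSpan D)))}
      (phiRel D hD M) :=
  ⟨Nat.sInf_mem (eta_set_nonempty _ _ (by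
    obtain ⟨S, hS, hf⟩ := (AddSubgroup.fg_iff _).1 (addSpan_fg M)
    rw [← hS, AddMonoidHom.map_closure]
    exact (AddSubgroup.fg_iff _).2 ⟨_, rfl, hf.image _⟩)), fun _ hk => Nat.sInf_le hk⟩

/-! ## Gorenstein projective modules -/

/-- `(P, d)` is a complete projective resolution: an exact complex
`⋯ → P i → P (i + 1) → ⋯` of finitely generated projective modules which stays exact under
`Hom(-, Q)` for every finitely generated projective module `Q`. -/
structure IsCompleteResolution (P : ℤ → FGModuleCat.{u} Λ)
    (d : ∀ i, P i →ₗ[Λ] P (i + 1)) : Prop where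
  projective : ∀ i, Module.Projective Λ (P i)
  exact : ∀ i, Function.Exact (d i) (d (i + 1))
  hom_exact : ∀ Q : FGModuleCat.{u} Λ, Module.Projective Λ Q → ∀ i,
    Function.Exact (fun ψ : P (i + 1 + 1) →ₗ[Λ] Q => ψ ∘ₗ d (i + 1))
      (fun ψ : P (i + 1) →ₗ[Λ] Q => ψ ∘ₗ d i)

/-- `G` is Gorenstein projective: it is isomorphic to the kernel of one of the differentials of a
complete projective resolution (by shifting, the kernel of the differential in degree `0`). -/
def IsGorensteinProjective (G : FGModuleCat.{u} Λ) : Prop :=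
  ∃ (P : ℤ → FGModuleCat.{u} Λ) (d : ∀ i, P i →ₗ[Λ] P (i + 1)),
    IsCompleteResolution P d ∧ ∃ i, Nonempty (G ≃ₗ[Λ] LinearMap.ker (d i))

/-- The class of Gorenstein projective modules. -/
def gorensteinProjectives (Λ : Type u) [Ring Λ] : Set (FGModuleCat.{u} Λ) :=
  {G | IsGorensteinProjective G}

theorem classSpan_gorensteinProjectives_le :
    classSpan (gorensteinProjectives Λ) ≤
      (classSpan (gorensteinProjectives Λ)).comap omegaBar := by
  refine (AddSubgroup.closure_le _).2 ?_
  rintro _ ⟨G, ⟨P, d, hPd, i, ⟨e⟩⟩, rfl⟩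
  obtain ⟨j, rfl⟩ : ∃ j, i = j + 1 := ⟨i - 1, by ring⟩
  have hx : ∀ x, d (j + 1) (d j x) = 0 := fun x => (hPd.exact j _).2 ⟨x, rfl⟩
  let g : P j →ₗ[Λ] LinearMap.ker (d (j + 1)) := (d j).codRestrict _ hx
  have hg : Function.Surjective g := by
    rintro ⟨y, hy⟩
    obtain ⟨x, hx⟩ := (hPd.exact j y).1 hy
    exact ⟨x, Subtype.ext hx⟩
  have hk : LinearMap.ker g = LinearMap.ker (d j) := LinearMap.ker_codRestrict _ _ _
  change omegaBar (cls G) ∈ classSpan (gorensteinProjectives Λ)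
  rw [omegaBar_cls, cls_syzygy_eq (N := kerMod (d (j + 1))) (hPd.projective j) g hg e]
  exact AddSubgroup.subset_closure
    ⟨_, ⟨P, d, hPd, j, ⟨LinearEquiv.ofEq _ _ hk⟩⟩, rfl⟩

/-- `Φ_[GP]`, the relative Igusa-Todorov function of the class of Gorenstein projective modules. -/
noncomputable def phiGP (M : FGModuleCat.{u} Λ) : ℕ :=
  phiRel (gorensteinProjectives Λ) classSpan_gorensteinProjectives_le M

end

end IgusaTodorov

/-!
Write `f` for the endomorphism `Ω̄` of `K₀` and `D` for the subgroup generated by the classes of the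
Gorenstein projective modules.

The decisive fact is that `f` maps `D` bijectively onto itself.  It is surjective because every
Gorenstein projective module is a syzygy of another one
(`classSpan_gorensteinProjectives_le_map`).  For injectivity, the cokernel of a left approximation
`M → P` by a projective module is determined by `M` up to projective summands (a dual form of
Schanuel's lemma, `schanuel_coker`), and over an Artin algebra such approximations exist, since
`Hom(M, Λ)` is finitely generated over the base ring (`exists_leftApprox`).  Hence "cosyzygy" is an
endomorphism of `K₀` (`exists_cosyzygyHom`), and it is a left inverse of `f` on `D`.

The rest is algebra of abelian groups (`exists_forall_eta_sup_eq`).  Put `X = ⟨add M⟩`, and let `k`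
be the number `η` of the image of `X` in `K₀ / D`.  If `Y ≤ D` and `f^(m+1) (x + y) = 0` with
`m ≥ k`, `x ∈ X`, `y ∈ Y`, then `f^(m+1) x ∈ D`, so `f^m x ∈ D`, so `f^m (x + y) ∈ D` is zero by
injectivity of `f` on `D`; thus `η_f(X + Y) ≤ k`.  Conversely, if `k > 0` there are `m ≥ k - 1` and
`x ∈ X` with `f^(m+1) x ∈ D` and `f^m x ∉ D`; writing `f^(m+1) x = f^(m+1) y` with `y ∈ D`, the
element `x - y` shows that `η_f(X + Y) ≥ m + 1 ≥ k` as soon as `y ∈ Y`.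

It remains to find a Gorenstein projective `G` with `y ∈ ⟨add G⟩ ≤ D`.  A finite direct sum of
Gorenstein projective modules whose classes occur in `y` satisfies the first condition
(`exists_mem_addSpan_of_mem_classSpan`).  The second one holds because direct summands of Gorenstein
projective modules are Gorenstein projective (`IsGorensteinProjective.of_isSummand`).  This is
proved by cutting complete resolutions into short exact sequences `0 → X → P → Y → 0` with `X → P` a
left projective approximation: a module is Gorenstein projective if and only if it belongs to some
class of modules in which such sequences can be continued in both directions
(`isGorensteinProjective_iff`), and such sequences restrict to direct summands of either end
(`ApproxSeq.exists_of_left_prod`, `ApproxSeq.exists_of_right_prod`).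
-/

namespace IgusaTodorov

universe u

/-! ### The number `η` and quotients -/

section Eta

variable {G : Type*} [AddCommGroup G]

theorem injOn_iterate_image_iff (f : G →+ G) (X : AddSubgroup G) (m : ℕ) :
    Set.InjOn f (f^[m] '' (X : Set G)) ↔ ∀ x ∈ X, f^[m + 1] x = 0 → f^[m] x = 0 := by
  constructor
  · intro h x hx h0
    refine h ⟨x, hx, rfl⟩ ⟨0, X.zero_mem, iterate_map_zero f m⟩ ?_
    rw [← Function.iterate_succ_apply' f, h0, map_zero]
  · rintro h _ ⟨x, hx, rfl⟩ _ ⟨y, hy, rfl⟩ hxy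
    rw [← sub_eq_zero, ← iterate_map_sub]
    refine h _ (X.sub_mem hx hy) ?_
    rw [iterate_map_sub, Function.iterate_succ_apply', Function.iterate_succ_apply', hxy, sub_self]

theorem eta_le_iff (f : G →+ G) {X : AddSubgroup G} (hX : X.FG) (k : ℕ) :
    eta f X ≤ k ↔ ∀ m ≥ k, ∀ x ∈ X, f^[m + 1] x = 0 → f^[m] x = 0 := by
  simp only [← injOn_iterate_image_iff]
  exact ⟨fun h m hm => Nat.sInf_mem (eta_set_nonempty f X hX) m (h.trans hm),
    fun h => Nat.sInf_le h⟩

theorem iterate_quotientMap_mk (f : G →+ G) (D : AddSubgroup G) (hD : D ≤ D.comap f) (m : ℕ)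
    (x : G) : (QuotientAddGroup.map D D f hD)^[m] (x : G ⧸ D) = ((f^[m] x : G) : G ⧸ D) := by
  induction m generalizing x with
  | zero => rfl
  | succ m ih => rw [Function.iterate_succ_apply, Function.iterate_succ_apply, ← ih]; rfl

theorem eta_quotientMap_le_iff (f : G →+ G) {X : AddSubgroup G} (hX : X.FG) (D : AddSubgroup G)
    (hD : D ≤ D.comap f) (k : ℕ) :
    eta (QuotientAddGroup.map D D f hD) (X.map (QuotientAddGroup.mk' D)) ≤ k ↔
      ∀ m ≥ k, ∀ x ∈ X, f^[m + 1] x ∈ D → f^[m] x ∈ D := by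
  have hX' : (X.map (QuotientAddGroup.mk' D)).FG := by
    obtain ⟨S, rfl, hS⟩ := (AddSubgroup.fg_iff _).1 hX
    rw [AddMonoidHom.map_closure]
    exact (AddSubgroup.fg_iff _).2 ⟨_, rfl, hS.image _⟩
  simp only [eta_le_iff _ hX', AddSubgroup.mem_map, forall_exists_index, and_imp,
    forall_apply_eq_imp_iff₂, QuotientAddGroup.mk'_apply, iterate_quotientMap_mk,
    QuotientAddGroup.eq_zero_iff]

/-- If `f` is bijective on `D`, then the number `η` of the image of `X` modulo `D` is the number
`η` of `X ⊔ Y` for every sufficiently large finitely generated subgroup `Y` of `D`; here "large"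
means that `Y` contains one particular element. -/
theorem exists_forall_eta_sup_eq (f : G →+ G) {X : AddSubgroup G} (hX : X.FG) (D : AddSubgroup G)
    (hD : D ≤ D.comap f) (hinj : ∀ d ∈ D, f d = 0 → d = 0) (hsurj : D ≤ D.map f) :
    ∃ y ∈ D, ∀ Y ≤ D, Y.FG → y ∈ Y →
      eta (QuotientAddGroup.map D D f hD) (X.map (QuotientAddGroup.mk' D)) = eta f (X ⊔ Y) := by
  set k := eta (QuotientAddGroup.map D D f hD) (X.map (QuotientAddGroup.mk' D)) with hk
  have hkey := (eta_quotientMap_le_iff f hX D hD k).1 le_rfl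
  have hDm : ∀ m, ∀ d ∈ D, f^[m] d ∈ D := by
    intro m d hd
    induction m with
    | zero => exact hd
    | succ m ih => rw [Function.iterate_succ_apply']; exact hD ih
  have hle : ∀ Y ≤ D, Y.FG → eta f (X ⊔ Y) ≤ k := by
    intro Y hY hYfg
    rw [eta_le_iff f (hX.sup hYfg)]
    intro m hm z hz h0
    obtain ⟨x, hx, y, hy, rfl⟩ := AddSubgroup.mem_sup.1 hz
    have h1 : f^[m + 1] x ∈ D := by
      rw [iterate_map_add, add_eq_zero_iff_eq_neg] at h0
      rw [h0]
      exact D.neg_mem (hDm _ y (hY hy))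
    refine hinj _ ?_ (by rwa [← Function.iterate_succ_apply' f])
    rw [iterate_map_add]
    exact D.add_mem (hkey m hm x hx h1) (hDm _ y (hY hy))
  by_cases hk0 : k = 0
  · exact ⟨0, D.zero_mem, fun Y hY hYfg _ => by have := hle Y hY hYfg; omega⟩
  -- The value `k - 1` is too small, and a witness `x` of this can be corrected by an element of
  -- `D` so that its iterate vanishes and not merely lies in `D`.
  have hlt : ¬ k ≤ k - 1 := by omega
  rw [hk, eta_quotientMap_le_iff f hX D hD, ← hk] at hlt
  push Not at hlt
  obtain ⟨m, hm, x, hx, h1, h2⟩ := hlt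
  have hs : ∀ n, ∀ d ∈ D, ∃ y ∈ D, f^[n] y = d := by
    intro n
    induction n with
    | zero => exact fun d hd => ⟨d, hd, rfl⟩
    | succ n ih =>
      intro d hd
      obtain ⟨y, hy, rfl⟩ := hsurj hd
      obtain ⟨z, hz, rfl⟩ := ih y hy
      exact ⟨z, hz, Function.iterate_succ_apply' _ _ _⟩
  obtain ⟨y, hy, hyx⟩ := hs _ _ h1
  refine ⟨y, hy, fun Y hY hYfg hyY => le_antisymm ?_ (hle Y hY hYfg)⟩
  by_contra! hlt
  have := (eta_le_iff f (hX.sup hYfg) m).1 (by omega) m le_rfl (x - y)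
    ((X ⊔ Y).sub_mem (AddSubgroup.mem_sup_left hx) (AddSubgroup.mem_sup_right hyY))
    (by rw [iterate_map_sub, hyx, sub_self])
  rw [iterate_map_sub, sub_eq_zero] at this
  exact h2 (this ▸ hDm m y hy)

end Eta

/-! ### Direct summands and `⟨add M⟩` -/

section AddSpan

variable {Λ : Type u} [Ring Λ]

theorem IsSummand.trans {N M L : FGModuleCat.{u} Λ} (h : IsSummand N M) (h' : IsSummand M L) :
    IsSummand N L := by
  obtain ⟨N', ⟨e⟩⟩ := h
  obtain ⟨M', ⟨e'⟩⟩ := h'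
  exact ⟨FGModuleCat.of Λ (N' × M'),
    ⟨e'.trans ((e.prodCongr (LinearEquiv.refl Λ M')).trans (LinearEquiv.prodAssoc Λ N N' M'))⟩⟩

theorem isSummand_left {M Y Z : FGModuleCat.{u} Λ} (e : M ≃ₗ[Λ] (Y × Z)) : IsSummand Y M :=
  ⟨Z, ⟨e⟩⟩

theorem isSummand_right {M Y Z : FGModuleCat.{u} Λ} (e : M ≃ₗ[Λ] (Y × Z)) : IsSummand Z M :=
  ⟨Y, ⟨e.trans (LinearEquiv.prodComm Λ Y Z)⟩⟩

theorem addSpan_mono {N M : FGModuleCat.{u} Λ} (h : IsSummand N M) : addSpan N ≤ addSpan M := by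
  refine AddSubgroup.closure_mono ?_
  rintro _ ⟨L, hL, hs, rfl⟩
  exact ⟨L, hL, hs.trans h, rfl⟩

variable [IsArtinianRing Λ]

theorem addSpan_sum {M Y Z : FGModuleCat.{u} Λ} (e : M ≃ₗ[Λ] (Y × Z)) :
    addSpan M = addSpan Y ⊔ addSpan Z := by
  refine le_antisymm ((AddSubgroup.closure_le _).2 ?_)
    (sup_le (addSpan_mono (isSummand_left e)) (addSpan_mono (isSummand_right e)))
  rintro _ ⟨N, hN, hs, rfl⟩
  rcases isSummand_cases hN hs e with h | h
  · exact AddSubgroup.mem_sup_left (AddSubgroup.subset_closure ⟨N, hN, h, rfl⟩)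
  · exact AddSubgroup.mem_sup_right (AddSubgroup.subset_closure ⟨N, hN, h, rfl⟩)

/-- Existence of a decomposition into indecomposables, seen in `K₀`. -/
theorem cls_mem_addSpan (M : FGModuleCat.{u} Λ) : cls M ∈ addSpan M := by
  induction hM : Module.length Λ M using WellFoundedLT.induction generalizing M with
  | _ n ih =>
  subst hM
  by_cases hI : CategoryTheory.Indecomposable M.obj
  · have e : M ≃ₗ[Λ] (M × FGModuleCat.of Λ PUnit.{u + 1}) :=
      (LinearEquiv.prodUnique (R := Λ) (M := M) (M₂ := PUnit.{u + 1})).symm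
    exact AddSubgroup.subset_closure ⟨M, hI, isSummand_left e, rfl⟩
  by_cases h0 : Subsingleton M
  · rw [cls_proj M inferInstance]
    exact zero_mem _
  obtain ⟨Y, Z, e, hY, hZ⟩ : ∃ Y Z : ModuleCat.{u} Λ,
      ∃ _ : M.obj ≅ CategoryTheory.Limits.biprod Y Z, ¬ Subsingleton Y ∧ ¬ Subsingleton Z := by
    by_contra! hc
    refine hI ⟨fun h => h0 ((isZero_iff_subsingleton _).1 h), fun Y Z e => ?_⟩
    rw [isZero_iff_subsingleton, isZero_iff_subsingleton]
    by_contra! hc'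
    exact absurd (hc Y Z e hc'.1) (not_subsingleton_iff_nontrivial.2 hc'.2)
  let e' : M ≃ₗ[Λ] (Y × Z) := (e ≪≫ ModuleCat.biprodIsoProd Y Z).toLinearEquiv
  have fY : Module.Finite Λ Y := Module.Finite.of_surjective
    (LinearMap.fst Λ Y Z ∘ₗ e'.toLinearMap) (Prod.fst_surjective.comp e'.surjective)
  have fZ : Module.Finite Λ Z := Module.Finite.of_surjective
    (LinearMap.snd Λ Y Z ∘ₗ e'.toLinearMap) (Prod.snd_surjective.comp e'.surjective)
  have hl : Module.length Λ M = Module.length Λ Y + Module.length Λ Z := by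
    rw [e'.length_eq, Module.length_prod]
  have tY : Module.length Λ Y ≠ ⊤ := Module.length_ne_top
  have tZ : Module.length Λ Z ≠ ⊤ := Module.length_ne_top
  have pY : Module.length Λ Y ≠ 0 := fun h => hY ((Module.length_eq_zero_iff (R := Λ)).1 h)
  have pZ : Module.length Λ Z ≠ 0 := fun h => hZ ((Module.length_eq_zero_iff (R := Λ)).1 h)
  have lt : ∀ {a b : ℕ∞}, a ≠ ⊤ → b ≠ 0 → a < a + b := fun {a b} ha hb => by
    simpa using (ENat.add_lt_add_iff_left ha).2 (pos_iff_ne_zero.2 hb)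
  have sY := ih (Module.length Λ Y) (by rw [hl]; exact lt tY pZ) (FGModuleCat.of Λ Y) rfl
  have sZ := ih (Module.length Λ Z) (by rw [hl, add_comm]; exact lt tZ pY) (FGModuleCat.of Λ Z) rfl
  rw [cls_sum (M' := FGModuleCat.of Λ Y) (M'' := FGModuleCat.of Λ Z) e',
    addSpan_sum (Y := FGModuleCat.of Λ Y) (Z := FGModuleCat.of Λ Z) e']
  exact add_mem (AddSubgroup.mem_sup_left sY) (AddSubgroup.mem_sup_right sZ)

end AddSpan

/-! ### Cokernels of left projective approximations -/

section Cokernel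

variable {Λ : Type u} [Ring Λ]

section

variable {P P' C C' Q : Type*} [AddCommGroup P] [Module Λ P] [AddCommGroup P'] [Module Λ P']
  [AddCommGroup C] [Module Λ C] [AddCommGroup C'] [Module Λ C'] [AddCommGroup Q] [Module Λ Q]

theorem exists_comp_eq_of_ker_le {f : P →ₗ[Λ] C} (hf : Function.Surjective f) {g : P →ₗ[Λ] Q}
    (h : LinearMap.ker f ≤ LinearMap.ker g) : ∃ k : C →ₗ[Λ] Q, k ∘ₗ f = g := by
  refine ⟨(LinearMap.ker f).liftQ g h ∘ₗ (f.quotKerEquivOfSurjective hf).symm.toLinearMap, ?_⟩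
  ext x
  simp [LinearMap.quotKerEquivOfSurjective_symm_apply]

theorem nonempty_equiv_of_ker_eq {f : P →ₗ[Λ] C} {g : P →ₗ[Λ] C'} (hf : Function.Surjective f)
    (hg : Function.Surjective g) (h : LinearMap.ker f = LinearMap.ker g) :
    Nonempty (C ≃ₗ[Λ] C') :=
  ⟨(f.quotKerEquivOfSurjective hf).symm.trans
    ((Submodule.quotEquivOfEq _ _ h).trans (g.quotKerEquivOfSurjective hg))⟩

/-- The dual of Schanuel's lemma.  Instead of injectivity of `P` and `P'` it is assumed that the
maps `α` and `α'` factor through each other. -/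
theorem schanuel_coker {M M' : Type*} [AddCommGroup M] [Module Λ M] [AddCommGroup M'] [Module Λ M']
    {α : M →ₗ[Λ] P} {π : P →ₗ[Λ] C} {α' : M' →ₗ[Λ] P'} {π' : P' →ₗ[Λ] C'}
    (hα : Function.Exact α π) (hα' : Function.Exact α' π') (hπ : Function.Surjective π)
    (hπ' : Function.Surjective π') (e : M ≃ₗ[Λ] M') (s : P →ₗ[Λ] P') (t : P' →ₗ[Λ] P)
    (hs : ∀ m, s (α m) = α' (e m)) (ht : ∀ m, t (α' (e m)) = α m) :
    Nonempty ((C × P') ≃ₗ[Λ] (C' × P)) := by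
  -- An automorphism of `P × P'` (up to the order of the factors) which moves the image of `α` in
  -- the first factor to the image of `α'` in the second one.
  let θ : (P × P') →ₗ[Λ] (P' × P) :=
    (LinearMap.snd Λ P P' + s ∘ₗ LinearMap.fst Λ P P').prod
      (LinearMap.fst Λ P P' - t ∘ₗ (LinearMap.snd Λ P P' + s ∘ₗ LinearMap.fst Λ P P'))
  have hθ : ∀ p p', θ (p, p') = (p' + s p, p - t (p' + s p)) := fun p p' => rfl
  have hθs : Function.Surjective θ := by
    rintro ⟨a, b⟩
    exact ⟨(b + t a, a - s (b + t a)), by simp [hθ]⟩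
  refine nonempty_equiv_of_ker_eq (f := π.prodMap (LinearMap.id : P' →ₗ[Λ] P'))
    (g := π'.prodMap (LinearMap.id : P →ₗ[Λ] P) ∘ₗ θ)
    (hπ.prodMap Function.surjective_id) ((hπ'.prodMap Function.surjective_id).comp hθs) ?_
  ext ⟨p, p'⟩
  simp only [LinearMap.mem_ker, LinearMap.comp_apply, hθ, LinearMap.prodMap_apply,
    LinearMap.id_apply, Prod.mk_eq_zero]
  constructor
  · rintro ⟨hp, rfl⟩
    obtain ⟨m, rfl⟩ := (hα p).1 hp
    simp only [zero_add, hs, ht, sub_self, and_true]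
    exact (hα' _).2 ⟨_, rfl⟩
  · rintro ⟨h1, h2⟩
    obtain ⟨m', hm'⟩ := (hα' _).1 h1
    obtain ⟨m, rfl⟩ := e.surjective m'
    rw [← hm', ht, sub_eq_zero] at h2
    subst h2
    rw [hs, eq_comm, add_eq_right] at hm'
    exact ⟨(hα _).2 ⟨_, rfl⟩, hm'⟩

end

/-- Every map from `M` to a finitely generated projective module extends along `α : M → P`.  If `P`
is finitely generated projective, this says that `α` is a left approximation of `M` by projective
modules. -/
def IsLeftApprox {M P : Type*} [AddCommGroup M] [Module Λ M] [AddCommGroup P] [Module Λ P]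
    (α : M →ₗ[Λ] P) : Prop :=
  ∀ Q : FGModuleCat.{u} Λ, Module.Projective Λ Q → ∀ g : M →ₗ[Λ] Q, ∃ h : P →ₗ[Λ] Q, h ∘ₗ α = g

theorem IsLeftApprox.prodMap {M P M' P' : Type*} [AddCommGroup M] [Module Λ M] [AddCommGroup P]
    [Module Λ P] [AddCommGroup M'] [Module Λ M'] [AddCommGroup P'] [Module Λ P']
    {α : M →ₗ[Λ] P} {α' : M' →ₗ[Λ] P'} (hα : IsLeftApprox α) (hα' : IsLeftApprox α') :
    IsLeftApprox (α.prodMap α') := by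
  intro Q hQ g
  obtain ⟨h, hh⟩ := hα Q hQ (g ∘ₗ LinearMap.inl Λ M M')
  obtain ⟨k, hk⟩ := hα' Q hQ (g ∘ₗ LinearMap.inr Λ M M')
  refine ⟨h.coprod k, LinearMap.ext fun x => ?_⟩
  change h (α x.1) + k (α' x.2) = g x
  have h1 : h (α x.1) = g (x.1, 0) := LinearMap.congr_fun hh x.1
  have h2 : k (α' x.2) = g (0, x.2) := LinearMap.congr_fun hk x.2
  rw [h1, h2, ← map_add]
  simp

/-- In `K₀`, the cokernel of a left projective approximation of `M` depends only on `M`. -/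
theorem cls_coker_eq {M M' P P' C C' : FGModuleCat.{u} Λ} (hP : Module.Projective Λ P)
    (hP' : Module.Projective Λ P') {α : M →ₗ[Λ] P} {α' : M' →ₗ[Λ] P'} {π : P →ₗ[Λ] C}
    {π' : P' →ₗ[Λ] C'} (ha : IsLeftApprox α) (ha' : IsLeftApprox α')
    (hα : Function.Exact α π) (hα' : Function.Exact α' π') (hπ : Function.Surjective π)
    (hπ' : Function.Surjective π') (e : M ≃ₗ[Λ] M') : cls C = cls C' := by
  obtain ⟨s, hs⟩ := ha P' hP' (α' ∘ₗ e.toLinearMap)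
  obtain ⟨t, ht⟩ := ha' P hP (α ∘ₗ e.symm.toLinearMap)
  obtain ⟨φ⟩ := schanuel_coker hα hα' hπ hπ' e s t (fun m => LinearMap.congr_fun hs m)
    (fun m => (LinearMap.congr_fun ht (e m)).trans (congrArg α (e.symm_apply_apply m)))
  have h1 : cls (FGModuleCat.of Λ (C × P')) = cls C + cls P' :=
    cls_sum (M := FGModuleCat.of Λ (C × P')) (LinearEquiv.refl Λ _)
  have h2 : cls (FGModuleCat.of Λ (C × P')) = cls C' + cls P :=
    cls_sum (M := FGModuleCat.of Λ (C × P')) φ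
  rwa [cls_proj P hP, add_zero, h1, cls_proj P' hP', add_zero] at h2

end Cokernel

/-! ### Exact sequences given by approximations -/

section ApproxSeq

variable {Λ : Type u} [Ring Λ]

/-- A short exact sequence `0 → X → P → Y → 0` of finitely generated modules with `P` projective,
in which `X → P` is a left projective approximation. -/
structure ApproxSeq (X Y : FGModuleCat.{u} Λ) where
  /-- The projective module in the middle. -/
  P : FGModuleCat.{u} Λ
  /-- The left approximation. -/
  ι : X →ₗ[Λ] P
  /-- The projection onto the cokernel. -/
  π : P →ₗ[Λ] Y
  projective : Module.Projective Λ P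
  injective : Function.Injective ι
  surjective : Function.Surjective π
  exact : Function.Exact ι π
  approx : IsLeftApprox ι

namespace ApproxSeq

variable {X Y X' Y' : FGModuleCat.{u} Λ}

/-- The left-hand term of the sequence as a kernel. -/
noncomputable def equivKer (s : ApproxSeq X Y) : X ≃ₗ[Λ] LinearMap.ker s.π :=
  (LinearEquiv.ofInjective s.ι s.injective).trans
    (LinearEquiv.ofEq _ _ s.exact.linearMap_ker_eq.symm)

/-- Transport of the sequence along isomorphisms of its ends. -/
def congr (s : ApproxSeq X Y) (e : X' ≃ₗ[Λ] X) (e' : Y ≃ₗ[Λ] Y') : ApproxSeq X' Y' where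
  P := s.P
  ι := s.ι ∘ₗ e.toLinearMap
  π := e'.toLinearMap ∘ₗ s.π
  projective := s.projective
  injective := s.injective.comp e.injective
  surjective := e'.surjective.comp s.surjective
  exact := by
    intro p
    simp only [LinearMap.comp_apply, LinearEquiv.coe_coe, e'.map_eq_zero_iff, s.exact p,
      LinearMap.coe_comp, Set.mem_range, Function.comp_apply]
    exact e.surjective.exists
  approx := by
    intro Q hQ g
    obtain ⟨h, hh⟩ := s.approx Q hQ (g ∘ₗ e.symm.toLinearMap)
    refine ⟨h, ?_⟩
    rw [← LinearMap.comp_assoc, hh]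
    ext x
    simp

/-- The direct sum of two sequences. -/
def prod (s : ApproxSeq X Y) (t : ApproxSeq X' Y') :
    ApproxSeq (FGModuleCat.of Λ (X × X')) (FGModuleCat.of Λ (Y × Y')) where
  P := FGModuleCat.of Λ (s.P × t.P)
  ι := s.ι.prodMap t.ι
  π := s.π.prodMap t.π
  projective :=
    have := s.projective
    have := t.projective
    inferInstanceAs (Module.Projective Λ (s.P × t.P))
  injective := s.injective.prodMap t.injective
  surjective := s.surjective.prodMap t.surjective
  exact := by
    rintro ⟨p, q⟩
    refine Prod.mk_eq_zero.trans ((and_congr (s.exact p) (t.exact q)).trans ?_)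
    constructor
    · rintro ⟨⟨x, rfl⟩, ⟨y, rfl⟩⟩
      exact ⟨(x, y), rfl⟩
    · rintro ⟨⟨x, y⟩, h⟩
      exact ⟨⟨x, congrArg Prod.fst h⟩, ⟨y, congrArg Prod.snd h⟩⟩
  approx := s.approx.prodMap t.approx

/-- The sequence `0 → Q → Q → 0 → 0`. -/
def projLeft (Q : FGModuleCat.{u} Λ) (hQ : Module.Projective Λ Q) :
    ApproxSeq Q (FGModuleCat.of Λ PUnit.{u + 1}) where
  P := Q
  ι := LinearMap.id
  π := 0
  projective := hQ
  injective := Function.injective_id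
  surjective := fun _ => ⟨0, rfl⟩
  exact := fun q => ⟨fun _ => ⟨q, rfl⟩, fun _ => rfl⟩
  approx := fun _ _ g => ⟨g, rfl⟩

/-- The sequence `0 → 0 → Q → Q → 0`. -/
def projRight (Q : FGModuleCat.{u} Λ) (hQ : Module.Projective Λ Q) :
    ApproxSeq (FGModuleCat.of Λ PUnit.{u + 1}) Q where
  P := Q
  ι := 0
  π := LinearMap.id
  projective := hQ
  injective := fun _ _ _ => rfl
  surjective := Function.surjective_id
  exact := fun _ => ⟨fun h => ⟨0, h.symm⟩, fun ⟨_, h⟩ => h.symm⟩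
  approx := fun _ _ _ => ⟨0, LinearMap.ext fun x => by
    rw [show x = 0 from rfl, map_zero, map_zero]⟩

/-- If `N × N'` is the right-hand end of a sequence, then so is `N`; the new left-hand end is a
direct summand of the old one up to a projective module. -/
theorem exists_of_right_prod [IsArtinianRing Λ] {W U N N' : FGModuleCat.{u} Λ} (s : ApproxSeq W U)
    (e : U ≃ₗ[Λ] (N × N')) : ∃ W₁ W₂ Q : FGModuleCat.{u} Λ, Module.Projective Λ Q ∧
      Nonempty (ApproxSeq W₁ N) ∧ Nonempty ((W₁ × W₂) ≃ₗ[Λ] (W × Q)) := by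
  have hP := s.projective
  let a : s.P →ₗ[Λ] N := LinearMap.fst Λ N N' ∘ₗ e.toLinearMap ∘ₗ s.π
  let b : s.P →ₗ[Λ] N' := LinearMap.snd Λ N N' ∘ₗ e.toLinearMap ∘ₗ s.π
  have ha : Function.Surjective a := Prod.fst_surjective.comp (e.surjective.comp s.surjective)
  have hb : Function.Surjective b := Prod.snd_surjective.comp (e.surjective.comp s.surjective)
  have hab : ∀ p, e (s.π p) = (a p, b p) := fun p => rfl
  refine ⟨FGModuleCat.of Λ (LinearMap.ker a), FGModuleCat.of Λ (LinearMap.ker b × s.P),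
    FGModuleCat.of Λ (s.P × s.P), inferInstanceAs (Module.Projective Λ (s.P × s.P)), ⟨?_⟩, ?_⟩
  · refine ⟨s.P, (LinearMap.ker a).subtype, a, hP, Subtype.val_injective, ha, ?_, ?_⟩
    · intro p
      exact ⟨fun h => ⟨⟨p, h⟩, rfl⟩, fun ⟨q, h⟩ => h ▸ q.2⟩
    · intro Q hQ (g : LinearMap.ker a →ₗ[Λ] Q)
      have hW : ∀ w, s.ι w ∈ LinearMap.ker a := fun w => by
        have h : s.π (s.ι w) = 0 := (s.exact _).2 ⟨w, rfl⟩
        change (e (s.π (s.ι w))).1 = 0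
        rw [h, map_zero]
        rfl
      -- Extend the restriction of `g` to `W`; the error is a map `ker a → Q` which vanishes on `W`,
      -- so that it factors through the restriction of `b`, which is defined on all of `P`.
      obtain ⟨h, hh⟩ := s.approx Q hQ (g ∘ₗ s.ι.codRestrict _ hW)
      have hh' : ∀ w, h (s.ι w) = g ⟨s.ι w, hW w⟩ := fun w => LinearMap.congr_fun hh w
      have hb' : Function.Surjective (b ∘ₗ (LinearMap.ker a).subtype) := by
        intro n
        obtain ⟨u, hu⟩ := e.surjective (0, n)
        obtain ⟨p, rfl⟩ := s.surjective u
        rw [hab, Prod.mk.injEq] at hu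
        exact ⟨⟨p, hu.1⟩, hu.2⟩
      obtain ⟨c, hc⟩ := exists_comp_eq_of_ker_le hb' (g := g - h ∘ₗ (LinearMap.ker a).subtype) (by
        rintro ⟨p, hp⟩ hp'
        have h0 : s.π p = 0 := e.map_eq_zero_iff.1 (Prod.ext hp hp')
        obtain ⟨w, rfl⟩ := (s.exact p).1 h0
        change g ⟨s.ι w, hp⟩ - h (s.ι w) = 0
        rw [hh', sub_self])
      refine ⟨h + c ∘ₗ b, LinearMap.ext fun x => ?_⟩
      have hx : c (b x.1) = g x - h x.1 := LinearMap.congr_fun hc x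
      change h x.1 + c (b x.1) = g x
      rw [hx, add_sub_cancel]
  · obtain ⟨φ⟩ := schanuel (a.prodMap b) s.π (ha.prodMap hb) s.surjective e.symm
    let κ : LinearMap.ker (a.prodMap b) ≃ₗ[Λ] (LinearMap.ker a × LinearMap.ker b) :=
      { toFun := fun x => (⟨x.1.1, congrArg Prod.fst x.2⟩, ⟨x.1.2, congrArg Prod.snd x.2⟩)
        invFun := fun y => ⟨(y.1.1, y.2.1), Prod.ext y.1.2 y.2.2⟩
        map_add' := fun _ _ => rfl
        map_smul' := fun _ _ => rfl
        left_inv := fun _ => rfl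
        right_inv := fun _ => rfl }
    exact ⟨(LinearEquiv.prodAssoc Λ _ _ _).symm.trans <|
      (κ.symm.prodCongr (LinearEquiv.refl Λ s.P)).trans <|
      (LinearEquiv.prodComm Λ _ _).trans <| φ.symm.trans <|
      (LinearEquiv.prodComm Λ _ _).trans <| s.equivKer.symm.prodCongr (LinearEquiv.refl Λ _)⟩

/-- If `N × N'` is the left-hand end of a sequence, then so is `N`; the new right-hand end is a
direct summand of the old one up to a projective module. -/
theorem exists_of_left_prod {U Y N N' : FGModuleCat.{u} Λ} (s : ApproxSeq U Y)
    (e : U ≃ₗ[Λ] (N × N')) : ∃ Y₁ Y₂ Q : FGModuleCat.{u} Λ, Module.Projective Λ Q ∧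
      Nonempty (ApproxSeq N Y₁) ∧ Nonempty ((Y₁ × Y₂) ≃ₗ[Λ] (Y × Q)) := by
  have hP := s.projective
  let a : N →ₗ[Λ] s.P := s.ι ∘ₗ e.symm.toLinearMap ∘ₗ LinearMap.inl Λ N N'
  let b : N' →ₗ[Λ] s.P := s.ι ∘ₗ e.symm.toLinearMap ∘ₗ LinearMap.inr Λ N N'
  have ha : Function.Injective a :=
    s.injective.comp (e.symm.injective.comp LinearMap.inl_injective)
  have hPP : Module.Projective Λ (FGModuleCat.of Λ (s.P × s.P)) :=
    inferInstanceAs (Module.Projective Λ (s.P × s.P))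
  refine ⟨FGModuleCat.of Λ (s.P ⧸ LinearMap.range a),
    FGModuleCat.of Λ ((s.P ⧸ LinearMap.range b) × s.P),
    FGModuleCat.of Λ (s.P × s.P), hPP, ⟨?_⟩, ?_⟩
  · refine ⟨s.P, a, (LinearMap.range a).mkQ, hP, ha, Submodule.mkQ_surjective _,
      LinearMap.exact_map_mkQ_range a, ?_⟩
    intro Q hQ g
    obtain ⟨h, hh⟩ := s.approx Q hQ (g ∘ₗ LinearMap.fst Λ N N' ∘ₗ e.toLinearMap)
    refine ⟨h, LinearMap.ext fun n => ?_⟩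
    refine (LinearMap.congr_fun hh (e.symm (n, 0))).trans ?_
    simp
  · obtain ⟨σ, hσ⟩ := s.approx (FGModuleCat.of Λ (s.P × s.P)) hPP (a.prodMap b ∘ₗ e.toLinearMap)
    have hex : Function.Exact (a.prodMap b)
        ((LinearMap.range a).mkQ.prodMap (LinearMap.range b).mkQ) := by
      rw [LinearMap.exact_iff, LinearMap.ker_prodMap, LinearMap.range_prodMap, Submodule.ker_mkQ,
        Submodule.ker_mkQ]
    obtain ⟨φ⟩ := schanuel_coker s.exact hex s.surjective
      ((Submodule.mkQ_surjective _).prodMap (Submodule.mkQ_surjective _)) e σ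
      (LinearMap.coprod LinearMap.id LinearMap.id) (fun u => LinearMap.congr_fun hσ u) (fun u => by
        change s.ι (e.symm ((e u).1, 0)) + s.ι (e.symm (0, (e u).2)) = s.ι u
        rw [← map_add, ← map_add]
        simp)
    exact ⟨(LinearEquiv.prodAssoc Λ _ _ _).symm.trans φ.symm⟩

end ApproxSeq

end ApproxSeq

/-! ### Gorenstein projective modules -/

section GorensteinProjective

variable {Λ : Type u} [Ring Λ]

/-- A class of modules is closed under approximation sequences if each of its members is the
left-hand end of some approximation sequence, and also the right-hand end of some approximation
sequence, whose other end lies in the class as well. -/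
def IsApproxClosed (S : Set (FGModuleCat.{u} Λ)) : Prop :=
  ∀ X ∈ S, (∃ Y ∈ S, Nonempty (ApproxSeq X Y)) ∧ ∃ W ∈ S, Nonempty (ApproxSeq W X)

/-- A relation that is total on both sides admits a bi-infinite chain through each element. -/
theorem exists_int_chain {S : Type*} (r : S → S → Prop) (hr : ∀ x, ∃ y, r x y)
    (hl : ∀ x, ∃ w, r w x) (x₀ : S) : ∃ a : ℤ → S, a 0 = x₀ ∧ ∀ i, r (a i) (a (i + 1)) := by
  choose R hR using hr
  choose L hL using hl
  let a : ℤ → S := fun i => Int.rec (fun n => R^[n] x₀) (fun n => L^[n + 1] x₀) i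
  refine ⟨a, rfl, ?_⟩
  rintro (n | n)
  · change r (R^[n] x₀) (R^[n + 1] x₀)
    rw [Function.iterate_succ_apply']
    exact hR _
  · have h : a (Int.negSucc n + 1) = L^[n] x₀ := by
      rcases n with _ | n
      · rfl
      · rfl
    rw [h]
    change r (L^[n + 1] x₀) _
    rw [Function.iterate_succ_apply']
    exact hL _

variable [IsArtinianRing Λ]

/-- A complete projective resolution is cut into approximation sequences by its kernels. -/
theorem IsCompleteResolution.nonempty_approxSeq {P : ℤ → FGModuleCat.{u} Λ}
    {d : ∀ i, P i →ₗ[Λ] P (i + 1)} (h : IsCompleteResolution P d) (i : ℤ) :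
    Nonempty (ApproxSeq (kerMod (d i)) (kerMod (d (i + 1)))) := by
  obtain ⟨j, rfl⟩ : ∃ j, i = j + 1 + 1 := ⟨i - 1 - 1, by ring⟩
  have hx : ∀ k x, d (k + 1) (d k x) = 0 := fun k x => (h.exact k _).2 ⟨x, rfl⟩
  refine ⟨⟨P (j + 1 + 1), (LinearMap.ker (d (j + 1 + 1))).subtype,
    (d (j + 1 + 1)).codRestrict _ (hx _), h.projective _, Subtype.val_injective, ?_, ?_, ?_⟩⟩
  · rintro ⟨y, hy⟩
    obtain ⟨x, hx⟩ := (h.exact _ y).1 hy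
    exact ⟨x, Subtype.ext hx⟩
  · intro p
    exact ⟨fun hp => ⟨⟨p, congrArg Subtype.val hp⟩, rfl⟩, fun ⟨q, hq⟩ => Subtype.ext (hq ▸ q.2)⟩
  · intro Q hQ (g : LinearMap.ker (d (j + 1 + 1)) →ₗ[Λ] Q)
    obtain ⟨k, hk⟩ := (h.hom_exact Q hQ j (g ∘ₗ (d (j + 1)).codRestrict _ (hx (j + 1)))).1 (by
      ext x
      change g ⟨d (j + 1) (d j x), _⟩ = 0
      rw [← map_zero g]
      exact congrArg g (Subtype.ext (hx j x)))
    refine ⟨k, LinearMap.ext ?_⟩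
    rintro ⟨y, hy⟩
    obtain ⟨x, rfl⟩ := (h.exact _ y).1 hy
    exact LinearMap.congr_fun hk x

/-- Gorenstein projectivity in terms of short exact sequences. -/
theorem isGorensteinProjective_iff {G : FGModuleCat.{u} Λ} :
    IsGorensteinProjective G ↔ ∃ S : Set (FGModuleCat.{u} Λ), IsApproxClosed S ∧ G ∈ S := by
  constructor
  · rintro ⟨P, d, hPd, i, ⟨e⟩⟩
    refine ⟨{X | ∃ i, Nonempty (X ≃ₗ[Λ] LinearMap.ker (d i))}, ?_, i, ⟨e⟩⟩
    rintro X ⟨j, ⟨e⟩⟩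
    refine ⟨⟨kerMod (d (j + 1)), ⟨j + 1, ⟨LinearEquiv.refl Λ _⟩⟩, ?_⟩, ?_⟩
    · exact (hPd.nonempty_approxSeq j).map fun s => s.congr e (LinearEquiv.refl Λ _)
    · obtain ⟨k, rfl⟩ : ∃ k, j = k + 1 := ⟨j - 1, by ring⟩
      exact ⟨kerMod (d k), ⟨k, ⟨LinearEquiv.refl Λ _⟩⟩,
        (hPd.nonempty_approxSeq k).map fun s => s.congr (LinearEquiv.refl Λ _) e.symm⟩
  · rintro ⟨S, hS, hG⟩
    obtain ⟨a, ha0, ha⟩ := exists_int_chain (S := S) (fun X Y => Nonempty (ApproxSeq X.1 Y.1))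
      (fun X => let ⟨Y, hY, h⟩ := (hS X.1 X.2).1; ⟨⟨Y, hY⟩, h⟩)
      (fun X => let ⟨W, hW, h⟩ := (hS X.1 X.2).2; ⟨⟨W, hW⟩, h⟩) ⟨G, hG⟩
    -- Splice the sequences of the chain.
    let s : ∀ i, ApproxSeq (a i).1 (a (i + 1)).1 := fun i => (ha i).some
    let d : ∀ i, (s i).P →ₗ[Λ] (s (i + 1)).P := fun i => (s (i + 1)).ι ∘ₗ (s i).π
    have hker : ∀ i, LinearMap.ker (d i) = LinearMap.ker (s i).π := fun i =>
      LinearMap.ker_comp_of_ker_eq_bot _ (LinearMap.ker_eq_bot.2 (s (i + 1)).injective)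
    have hrange : ∀ i, LinearMap.range (d i) = LinearMap.range (s (i + 1)).ι := fun i =>
      LinearMap.range_comp_of_range_eq_top _ (LinearMap.range_eq_top.2 (s i).surjective)
    have hex : ∀ i, Function.Exact (d i) (d (i + 1)) := fun i => by
      rw [LinearMap.exact_iff, hker, hrange]
      exact (s (i + 1)).exact.linearMap_ker_eq
    refine ⟨fun i => (s i).P, d, ⟨fun i => (s i).projective, hex, ?_⟩, 0, ⟨?_⟩⟩
    · intro Q hQ i ψ
      constructor
      · intro hψ
        have hψ0 : ∀ x, ψ ((s (i + 1)).ι x) = 0 := fun x => by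
          obtain ⟨y, rfl⟩ := (s i).surjective x
          exact LinearMap.congr_fun hψ y
        obtain ⟨g, hg⟩ := exists_comp_eq_of_ker_le (s (i + 1)).surjective (g := ψ) (by
          rw [(s (i + 1)).exact.linearMap_ker_eq]
          rintro _ ⟨x, rfl⟩
          exact hψ0 x)
        obtain ⟨h, hh⟩ := (s (i + 1 + 1)).approx Q hQ g
        refine ⟨h, ?_⟩
        change h ∘ₗ ((s (i + 1 + 1)).ι ∘ₗ (s (i + 1)).π) = ψ
        rw [← LinearMap.comp_assoc, hh, hg]
      · rintro ⟨h, rfl⟩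
        ext x
        change h (d (i + 1) (d i x)) = 0
        rw [(hex i _).2 ⟨x, rfl⟩, map_zero]
    · have e : G ≃ₗ[Λ] LinearMap.ker (s 0).π :=
        (show G ≃ₗ[Λ] (a 0).1 by rw [ha0]).trans (s 0).equivKer
      exact e.trans (LinearEquiv.ofEq _ _ (hker 0).symm)

theorem isApproxClosed_gorensteinProjectives : IsApproxClosed (gorensteinProjectives Λ) := by
  intro X hX
  obtain ⟨S, hS, hXS⟩ := isGorensteinProjective_iff.1 hX
  exact ⟨let ⟨Y, hY, h⟩ := (hS X hXS).1; ⟨Y, isGorensteinProjective_iff.2 ⟨S, hS, hY⟩, h⟩,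
    let ⟨W, hW, h⟩ := (hS X hXS).2; ⟨W, isGorensteinProjective_iff.2 ⟨S, hS, hW⟩, h⟩⟩

theorem IsGorensteinProjective.of_projective (P : FGModuleCat.{u} Λ) (hP : Module.Projective Λ P) :
    IsGorensteinProjective P := by
  refine isGorensteinProjective_iff.2 ⟨{Q | Module.Projective Λ Q}, fun Q hQ => ?_, hP⟩
  have h0 : Module.Projective Λ (FGModuleCat.of Λ PUnit.{u + 1}) :=
    inferInstanceAs (Module.Projective Λ PUnit.{u + 1})
  exact ⟨⟨_, h0, ⟨ApproxSeq.projLeft Q hQ⟩⟩, ⟨_, h0, ⟨ApproxSeq.projRight Q hQ⟩⟩⟩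

theorem IsGorensteinProjective.prod {G G' : FGModuleCat.{u} Λ} (hG : IsGorensteinProjective G)
    (hG' : IsGorensteinProjective G') : IsGorensteinProjective (FGModuleCat.of Λ (G × G')) := by
  refine isGorensteinProjective_iff.2 ⟨{U | ∃ X ∈ gorensteinProjectives Λ,
    ∃ X' ∈ gorensteinProjectives Λ, U = FGModuleCat.of Λ (X × X')}, ?_, G, hG, G', hG', rfl⟩
  rintro _ ⟨X, hX, X', hX', rfl⟩
  obtain ⟨⟨Y, hY, ⟨s⟩⟩, ⟨W, hW, ⟨t⟩⟩⟩ := isApproxClosed_gorensteinProjectives X hX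
  obtain ⟨⟨Y', hY', ⟨s'⟩⟩, ⟨W', hW', ⟨t'⟩⟩⟩ := isApproxClosed_gorensteinProjectives X' hX'
  exact ⟨⟨_, ⟨Y, hY, Y', hY', rfl⟩, ⟨s.prod s'⟩⟩, ⟨_, ⟨W, hW, W', hW', rfl⟩, ⟨t.prod t'⟩⟩⟩

/-- Direct summands of Gorenstein projective modules are Gorenstein projective: the class of all `N`
such that `N × N'` is Gorenstein projective for some `N'` is closed under approximation
sequences. -/
theorem IsGorensteinProjective.of_isSummand {N G : FGModuleCat.{u} Λ} (h : IsSummand N G)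
    (hG : IsGorensteinProjective G) : IsGorensteinProjective N := by
  obtain ⟨N', ⟨e⟩⟩ := h
  refine isGorensteinProjective_iff.2 ⟨{N | ∃ U ∈ gorensteinProjectives Λ, ∃ N' : FGModuleCat.{u} Λ,
    Nonempty (U ≃ₗ[Λ] (N × N'))}, ?_, G, hG, N', ⟨e⟩⟩
  clear! N G
  rintro N ⟨U, hU, N', ⟨e⟩⟩
  obtain ⟨⟨Y, hY, ⟨s⟩⟩, ⟨W, hW, ⟨t⟩⟩⟩ := isApproxClosed_gorensteinProjectives U hU
  obtain ⟨Y₁, Y₂, Q, hQ, h₁, ⟨φ⟩⟩ := s.exists_of_left_prod e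
  obtain ⟨W₁, W₂, Q', hQ', h₁', ⟨φ'⟩⟩ := t.exists_of_right_prod e
  exact ⟨⟨Y₁, ⟨_, hY.prod (.of_projective Q hQ), Y₂, ⟨φ.symm⟩⟩, h₁⟩,
    ⟨W₁, ⟨_, hW.prod (.of_projective Q' hQ'), W₂, ⟨φ'.symm⟩⟩, h₁'⟩⟩

theorem addSpan_le_classSpan_gorensteinProjectives {G : FGModuleCat.{u} Λ}
    (hG : IsGorensteinProjective G) : addSpan G ≤ classSpan (gorensteinProjectives Λ) := by
  refine AddSubgroup.closure_mono ?_
  rintro _ ⟨N, -, hN, rfl⟩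
  exact ⟨N, hG.of_isSummand hN, rfl⟩

/-- The subgroup generated by the classes of Gorenstein projective modules is the directed union of
the subgroups `⟨add G⟩` with `G` Gorenstein projective. -/
theorem exists_mem_addSpan_of_mem_classSpan {y : K0 Λ}
    (hy : y ∈ classSpan (gorensteinProjectives Λ)) :
    ∃ G : FGModuleCat.{u} Λ, IsGorensteinProjective G ∧ y ∈ addSpan G := by
  induction hy using AddSubgroup.closure_induction with
  | mem x hx =>
    obtain ⟨G, hG, rfl⟩ := hx
    exact ⟨G, hG, cls_mem_addSpan G⟩
  | zero =>
    exact ⟨FGModuleCat.of Λ PUnit.{u + 1}, .of_projective _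
      (inferInstanceAs (Module.Projective Λ PUnit.{u + 1})), zero_mem _⟩
  | add x y _ _ hx hy =>
    obtain ⟨G, hG, hx⟩ := hx
    obtain ⟨G', hG', hy⟩ := hy
    refine ⟨_, hG.prod hG', ?_⟩
    rw [addSpan_sum (M := FGModuleCat.of Λ (G × G')) (LinearEquiv.refl Λ _)]
    exact add_mem (AddSubgroup.mem_sup_left hx) (AddSubgroup.mem_sup_right hy)
  | neg x _ hx =>
    obtain ⟨G, hG, hx⟩ := hx
    exact ⟨G, hG, neg_mem hx⟩

end GorensteinProjective

/-! ### Left approximations over an Artin algebra and cosyzygies -/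

section Cosyzygy

variable {Λ : Type u} [Ring Λ]

/-- Over an Artin algebra every finitely generated module `M` has a left projective approximation:
take as components generators of the `R`-module `Hom(M, Λ)`, which is finitely generated. -/
theorem exists_leftApprox (R : Type*) [CommRing R] [IsArtinianRing R] [Algebra R Λ]
    [Module.Finite R Λ] (M : FGModuleCat.{u} Λ) :
    ∃ (P : FGModuleCat.{u} Λ) (α : M →ₗ[Λ] P), Module.Projective Λ P ∧ IsLeftApprox α := by
  have : IsNoetherian R Λ := isNoetherian_of_isNoetherianRing_of_finite R Λ
  obtain ⟨n, g, hg⟩ := Module.Finite.exists_fin' Λ M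
  -- A map out of `M` is determined by its values on a finite set of generators of `M`.
  let ev : (M →ₗ[Λ] Λ) →ₗ[R] (Fin n → Λ) :=
    { toFun := fun ψ i => ψ (g (Pi.single i 1))
      map_add' := fun _ _ => rfl
      map_smul' := fun _ _ => rfl }
  have hev : Function.Injective ev := by
    intro ψ ψ' h
    have h' : ψ ∘ₗ g = ψ' ∘ₗ g := (Pi.basisFun Λ (Fin n)).ext fun i => by
      simpa using show ψ (g (Pi.single i 1)) = ψ' (g (Pi.single i 1)) from congrFun h i
    ext x
    obtain ⟨y, rfl⟩ := hg x
    exact LinearMap.congr_fun h' y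
  have hfin : Module.Finite R (M →ₗ[Λ] Λ) := Module.Finite.of_injective ev hev
  obtain ⟨m, q, hq⟩ := Module.Finite.exists_fin' R (M →ₗ[Λ] Λ)
  let α : M →ₗ[Λ] (Fin m → Λ) := LinearMap.pi fun j => q (Pi.single j 1)
  have hα : ∀ ψ : M →ₗ[Λ] Λ, ∃ h : (Fin m → Λ) →ₗ[Λ] Λ, h ∘ₗ α = ψ := by
    intro ψ
    obtain ⟨c, rfl⟩ := hq ψ
    refine ⟨∑ j, c j • LinearMap.proj j, LinearMap.ext fun x => ?_⟩
    have hc : c = ∑ j, c j • (Pi.single j 1 : Fin m → R) := pi_eq_sum_univ' c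
    conv_rhs => rw [hc]
    simp [α, LinearMap.sum_apply]
  refine ⟨FGModuleCat.of Λ (Fin m → Λ), α, inferInstanceAs (Module.Projective Λ (Fin m → Λ)), ?_⟩
  intro Q hQ g
  obtain ⟨l, p, hp⟩ := Module.Finite.exists_fin' Λ Q
  obtain ⟨σ, hσ⟩ := Module.projective_lifting_property p LinearMap.id hp
  choose h hh using fun j => hα (LinearMap.proj j ∘ₗ σ ∘ₗ g)
  refine ⟨p ∘ₗ LinearMap.pi h, LinearMap.ext fun x => ?_⟩
  have h1 : LinearMap.pi h (α x) = σ (g x) := funext fun j => LinearMap.congr_fun (hh j) x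
  change p (LinearMap.pi h (α x)) = g x
  rw [h1]
  exact LinearMap.congr_fun hσ (g x)

/-- There is an endomorphism of `K₀` sending the class of a module to the class of the cokernel of
any of its left projective approximations.  In particular it sends the left-hand end of an
approximation sequence to its right-hand end. -/
theorem exists_cosyzygyHom (R : Type*) [CommRing R] [IsArtinianRing R] [Algebra R Λ]
    [Module.Finite R Λ] :
    ∃ σ : K0 Λ →+ K0 Λ, ∀ (X Y : FGModuleCat.{u} Λ), ApproxSeq X Y → σ (cls X) = cls Y := by
  choose P α hP hα using exists_leftApprox (Λ := Λ) R
  let C : FGModuleCat.{u} Λ → FGModuleCat.{u} Λ := fun M =>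
    FGModuleCat.of Λ (P M ⧸ LinearMap.range (α M))
  have key : ∀ {M M' Q Y : FGModuleCat.{u} Λ} (_ : Module.Projective Λ Q) (β : M' →ₗ[Λ] Q)
      (π : Q →ₗ[Λ] Y), IsLeftApprox β → Function.Exact β π → Function.Surjective π →
      (M ≃ₗ[Λ] M') → cls (C M) = cls Y := by
    intro M M' Q Y hQ β π hβ hex hπ e
    exact cls_coker_eq (C := C M) (π := (LinearMap.range (α M)).mkQ) (hP M) hQ (hα M) hβ
      (LinearMap.exact_map_mkQ_range _) hex (Submodule.mkQ_surjective _) hπ e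
  let σ : K0 Λ →+ K0 Λ :=
    QuotientAddGroup.lift _ (FreeAbelianGroup.lift fun M => cls (C M)) (by
      rw [AddSubgroup.closure_le]
      rintro _ (⟨M, M', M'', e⟩ | ⟨Q, hQ⟩)
      · have h : cls (C M) = cls (FGModuleCat.of Λ (C M' × C M'')) := by
          have := hP M'
          have := hP M''
          refine key (M' := FGModuleCat.of Λ (M' × M''))
            (Q := FGModuleCat.of Λ (P M' × P M''))
            (inferInstanceAs (Module.Projective Λ (P M' × P M'')))
            ((α M').prodMap (α M'')) ((LinearMap.range (α M')).mkQ.prodMap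
              (LinearMap.range (α M'')).mkQ) ((hα M').prodMap (hα M'')) ?_
            ((Submodule.mkQ_surjective _).prodMap (Submodule.mkQ_surjective _)) e
          rw [LinearMap.exact_iff, LinearMap.ker_prodMap, LinearMap.range_prodMap,
            Submodule.ker_mkQ, Submodule.ker_mkQ]
        have h' : cls (FGModuleCat.of Λ (C M' × C M'')) = cls (C M') + cls (C M'') :=
          cls_sum (LinearEquiv.refl Λ _)
        simp [h, h']
      · let s := ApproxSeq.projLeft Q hQ
        have h : cls (C Q) = 0 :=
          (key s.projective s.ι s.π s.approx s.exact s.surjective (LinearEquiv.refl Λ Q)).trans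
            (cls_proj _ (inferInstanceAs (Module.Projective Λ PUnit.{u + 1})))
        simp [h])
  refine ⟨σ, fun X Y s => ?_⟩
  refine (FreeAbelianGroup.lift_apply_of _ _).trans ?_
  exact key s.projective s.ι s.π s.approx s.exact s.surjective (LinearEquiv.refl Λ X)

end Cosyzygy

/-! ### `Ω̄` is bijective on the classes of Gorenstein projective modules -/

section Omega

variable {Λ : Type u} [Ring Λ] [IsArtinianRing Λ]

theorem omegaBar_cls_of_approxSeq {X Y : FGModuleCat.{u} Λ} (s : ApproxSeq X Y) :
    omegaBar (cls Y) = cls X := by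
  rw [omegaBar_cls, cls_syzygy_eq s.projective s.π s.surjective (LinearEquiv.refl Λ Y)]
  exact cls_congr s.equivKer.symm

theorem classSpan_gorensteinProjectives_le_map :
    classSpan (gorensteinProjectives Λ) ≤ (classSpan (gorensteinProjectives Λ)).map omegaBar := by
  refine (AddSubgroup.closure_le _).2 ?_
  rintro _ ⟨G, hG, rfl⟩
  obtain ⟨Y, hY, ⟨s⟩⟩ := (isApproxClosed_gorensteinProjectives G hG).1
  exact ⟨cls Y, AddSubgroup.subset_closure ⟨Y, hY, rfl⟩, omegaBar_cls_of_approxSeq s⟩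

/-- On the classes of Gorenstein projective modules `Ω̄` has a left inverse, given by
cosyzygies. -/
theorem omegaBar_injOn_gorensteinProjectives (R : Type*) [CommRing R] [IsArtinianRing R]
    [Algebra R Λ] [Module.Finite R Λ] {x : K0 Λ} (hx : x ∈ classSpan (gorensteinProjectives Λ))
    (h0 : omegaBar x = 0) : x = 0 := by
  obtain ⟨σ, hσ⟩ := exists_cosyzygyHom (Λ := Λ) R
  have h : Set.EqOn (σ.comp omegaBar) (AddMonoidHom.id _)
      (classSpan (gorensteinProjectives Λ) : Set (K0 Λ)) := by
    refine AddMonoidHom.eqOn_closure ?_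
    rintro _ ⟨G, hG, rfl⟩
    obtain ⟨W, -, ⟨s⟩⟩ := (isApproxClosed_gorensteinProjectives G hG).2
    change σ (omegaBar (cls G)) = cls G
    rw [omegaBar_cls_of_approxSeq s, hσ _ _ s]
  have hx' : σ (omegaBar x) = x := h hx
  rw [← hx', h0, map_zero]

end Omega

end IgusaTodorov

theorem mainTheorem4 {R : Type*} [CommRing R] [IsArtinianRing R] {A : Type*} [Ring A] [Algebra R A]
    [Module.Finite R A] (M : FGModuleCat Aᵐᵒᵖ) :
    haveI : IsArtinianRing Aᵐᵒᵖ := IsArtinianRing.of_finite R Aᵐᵒᵖ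
    ∃ G : FGModuleCat Aᵐᵒᵖ, IgusaTodorov.IsGorensteinProjective G ∧
      IgusaTodorov.phiGP M = IgusaTodorov.phi (FGModuleCat.of Aᵐᵒᵖ (M × G)) := by
  have : IsArtinianRing Aᵐᵒᵖ := IsArtinianRing.of_finite R Aᵐᵒᵖ
  obtain ⟨y, hy, h⟩ := IgusaTodorov.exists_forall_eta_sup_eq IgusaTodorov.omegaBar
    (IgusaTodorov.addSpan_fg M) _ IgusaTodorov.classSpan_gorensteinProjectives_le
    (fun _ => IgusaTodorov.omegaBar_injOn_gorensteinProjectives R)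
    IgusaTodorov.classSpan_gorensteinProjectives_le_map
  obtain ⟨G, hG, hyG⟩ := IgusaTodorov.exists_mem_addSpan_of_mem_classSpan hy
  refine ⟨G, hG, ?_⟩
  rw [IgusaTodorov.phi, IgusaTodorov.addSpan_sum (M := FGModuleCat.of Aᵐᵒᵖ (M × G))
    (LinearEquiv.refl Aᵐᵒᵖ _)]
  exact h _ (IgusaTodorov.addSpan_le_classSpan_gorensteinProjectives hG)
    (IgusaTodorov.addSpan_fg G) hyG
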